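/- **Theorem 8.3.** For a real Banach space $X$, let $\mathcal{CLB}(X)$ be the set of all convex functions $h\colon X\to\mathbb R$ that are Lipschitz on every bounded subset of $X$. For $h\in\mathcal{CLB}(X)$ put $$h^*(x^*)=\sup_{x\in X}\big[\langle x,x^*\rangle-h(x)\big]\quad(x^*\in X^*),\qquad h^{**}(x^{**})=\sup_{x^*\in X^*}\big[\langle x^*,x^{**}\rangle-h^*(x^*)\big]\quad(x^{**}\in X^{**});$$ the function $h^{**}$ is real-valued. Let $\mathcal T_{\mathcal{CLB}}(X^{**})$ be the coarsest topology on $X^{**}$ that makes all the functions $h^{**}$, $h\in\mathcal{CLB}(X)$, continuous, and let $\mathcal T_{\|\,\|}(X)$ be the norm topology of $X$. Let $E$ be a nonzero real Banach space and let $B=E\times E^*$, with the norm $\|(x,x^*)\|_2=\sqrt{\|x\|^2+\|x^*\|^2}$. Represent $B^*$ by $E^*\times E^{**}$ under the pairing $\langle(x,x^*),(y^*,y^{**})\rangle=\langle x,y^*\rangle+\langle x^*,y^{**}\rangle$ (the dual norm is then $\|(y^*,y^{**})\|_2=\sqrt{\|y^*\|^2+\|y^{**}\|^2}$). Define a symmetric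 bilinear form on $B^*$ by $$\lceil(x^*,x^{**}),(y^*,y^{**})\rceil=\langle y^*,x^{**}\rangle+\langle x^*,y^{**}\rangle,$$ let $\widetilde q(b^*)=\tfrac12\lceil b^*,b^*\rceil$, so that $\widetilde q(y^*,y^{**})=\langle y^*,y^{**}\rangle$, and let $\widetilde\iota\colon B^*\to B^{**}$ be the bounded linear map with $\langle c^*,\widetilde\iota(b^*)\rangle=\lceil c^*,b^*\rceil$ for all $b^*,c^*\in B^*$. Let $\mathcal T_{\mathcal D}(B^*)$ be the coarsest topology on $B^*$ that makes $\widetilde\iota\colon B^*\to\big(B^{**},\mathcal T_{\mathcal{CLB}}(B^{**})\big)$ continuous. Then: (a) the topologies $\mathcal T_{\mathcal D}(B^*)$ and $\mathcal T_{\|\,\|}(E^*)\times\mathcal T_{\mathcal{CLB}}(E^{**})$ on $B^*=E^*\times E^{**}$ are identical; (b) $\widetilde q$ is $\mathcal T_{\mathcal D}(B^*)$-continuous. -/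

import Mathlib

/-! ## Conjugates and the topology `T_CLB` on the bidual -/

/-- The conjugate `f*(x*) = sup_x (⟨x, x*⟩ - f x)` of a real-valued function on a normed space, with
values in the extended reals. -/
noncomputable def fenchelConj {X : Type*} [NormedAddCommGroup X] [NormedSpace ℝ X]
    (f : X → ℝ) (φ : StrongDual ℝ X) : EReal :=
  ⨆ x : X, ((φ x : ℝ) : EReal) - (f x : EReal)

/-- The biconjugate `f**(x**) = sup_{x*} (⟨x*, x**⟩ - f*(x*))`, as a function on the bidual. -/
noncomputable def fenchelBiconj {X : Type*} [NormedAddCommGroup X] [NormedSpace ℝ X]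
    (f : X → ℝ) (ξ : StrongDual ℝ (StrongDual ℝ X)) : EReal :=
  ⨆ φ : StrongDual ℝ X, ((ξ φ : ℝ) : EReal) - fenchelConj f φ

/-- `CLB(X)`: the convex functions `X → ℝ` that are Lipschitz on every bounded subset of `X`. -/
def CLB (X : Type*) [NormedAddCommGroup X] [NormedSpace ℝ X] : Set (X → ℝ) :=
  {h | ConvexOn ℝ Set.univ h ∧
    ∀ s : Set X, Bornology.IsBounded s → ∃ K : NNReal, LipschitzOnWith K h s}

/-- `T_CLB(X**)`: the coarsest topology on the bidual making every `h**`, `h ∈ CLB(X)`, continuous.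
(For `h ∈ CLB(X)` the function `h**` is finite, so it does not matter whether it is regarded as a
function to `ℝ` or to `EReal`.) -/
noncomputable abbrev TCLB (X : Type*) [NormedAddCommGroup X] [NormedSpace ℝ X] :
    TopologicalSpace (StrongDual ℝ (StrongDual ℝ X)) :=
  ⨅ h ∈ CLB X, TopologicalSpace.induced (fenchelBiconj h) inferInstance

/-- The norm topology of a normed space. -/
abbrev normTopology (X : Type*) [NormedAddCommGroup X] : TopologicalSpace X :=
  UniformSpace.toTopologicalSpace

/-! ## Banach SSD spaces, Banach SSD duals, and the topology `T_D` -/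

/-- A Banach SSD space structure on a nonzero real Banach space `B`: a symmetric bilinear form `⌊·,·⌋`
with `|⌊b,c⌋| ≤ ‖b‖ ‖c‖`. -/
structure BanachSSD (B : Type*) [NormedAddCommGroup B] [NormedSpace ℝ B] [CompleteSpace B]
    [Nontrivial B] where
  form : B →ₗ[ℝ] B →ₗ[ℝ] ℝ
  symm : ∀ b c, form b c = form c b
  bound : ∀ b c, |form b c| ≤ ‖b‖ * ‖c‖

namespace BanachSSD

variable {B : Type*} [NormedAddCommGroup B] [NormedSpace ℝ B] [CompleteSpace B] [Nontrivial B]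

/-- The quadratic function `q(b) = ½⌊b,b⌋`. -/
noncomputable def q (S : BanachSSD B) (b : B) : ℝ := (1 / 2) * S.form b b

/-- The bounded linear map `ι : B → B*` with `⟨b, ι(c)⟩ = ⌊b,c⌋`. -/
noncomputable def iota (S : BanachSSD B) : B →L[ℝ] StrongDual ℝ B :=
  LinearMap.mkContinuous₂ S.form.flip 1 fun c b => by
    simpa [mul_comm] using S.bound b c

theorem iota_apply (S : BanachSSD B) (b c : B) : S.iota c b = S.form b c := rfl

/-- Transport of a Banach SSD space structure along a surjective linear isometry. -/
noncomputable def transport {C : Type*} [NormedAddCommGroup C] [NormedSpace ℝ C] [CompleteSpace C]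
    [Nontrivial C] (S : BanachSSD B) (e : B ≃ₗᵢ[ℝ] C) : BanachSSD C where
  form := S.form.compl₁₂ e.symm.toLinearEquiv.toLinearMap e.symm.toLinearEquiv.toLinearMap
  symm b c := S.symm _ _
  bound b c := by simpa using S.bound (e.symm b) (e.symm c)

end BanachSSD

/-- A Banach SSD dual of `(B, ⌊·,·⌋)`: a Banach SSD space structure `⌈·,·⌉` on the Banach space
dual `B*` (with the dual norm) such that `⌈ι(b), c*⌉ = ⟨b, c*⟩`. -/
structure BanachSSDDual {B : Type*} [NormedAddCommGroup B] [NormedSpace ℝ B] [CompleteSpace B]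
    [Nontrivial B] (S : BanachSSD B) extends BanachSSD (StrongDual ℝ B) where
  form_iota : ∀ (b : B) (c : StrongDual ℝ B), form (S.iota b) c = c b

/-- `T_D(B*)`: the coarsest topology on `B*` making `ι̃ : B* → (B**, T_CLB(B**))` continuous, where
`⟨c*, ι̃(b*)⟩ = ⌈c*, b*⌉`. -/
noncomputable abbrev TD {B : Type*} [NormedAddCommGroup B] [NormedSpace ℝ B] [CompleteSpace B]
    [Nontrivial B] {S : BanachSSD B} (D : BanachSSDDual S) : TopologicalSpace (StrongDual ℝ B) :=
  TopologicalSpace.induced D.iota (TCLB B)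

/-! ## The Banach SSD space `E × E*` and its dual `E* × E**` -/

/-- The canonical Banach SSD space structure on `X × X*`, normed by
`‖(x,x*)‖₂ = √(‖x‖² + ‖x*‖²)`: the form is `⌊(x,x*),(y,y*)⌋ = ⟨x,y*⟩ + ⟨y,x*⟩`. -/
noncomputable def prodSSD (X : Type*) [NormedAddCommGroup X] [NormedSpace ℝ X] [CompleteSpace X]
    [Nontrivial X] : BanachSSD (WithLp 2 (X × StrongDual ℝ X)) where
  form := LinearMap.mk₂ ℝ (fun a b => b.snd a.fst + a.snd b.fst)
    (fun a a' b => by simp; ring) (fun r a b => by simp; ring)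
    (fun a b b' => by simp; ring) (fun r a b => by simp; ring)
  symm a b := by simp [add_comm]
  bound a b := by
    simp only [LinearMap.mk₂_apply, WithLp.prod_norm_eq_of_L2]
    have h1 := b.snd.le_opNorm a.fst
    have h2 := a.snd.le_opNorm b.fst
    rw [Real.norm_eq_abs] at h1 h2
    rw [← Real.sqrt_mul (by positivity)]
    refine (abs_add_le _ _).trans (Real.le_sqrt_of_sq_le ?_)
    refine (pow_le_pow_left₀ (by positivity) (add_le_add h1 h2) 2).trans ?_
    nlinarith [sq_nonneg (‖a.fst‖ * ‖b.fst‖ - ‖a.snd‖ * ‖b.snd‖)]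

/-- The functional `(x,y) ↦ ⟨x,φ⟩ + ⟨y,ψ⟩` on `X × Y`. -/
noncomputable def pairFunctional {X Y : Type*} [NormedAddCommGroup X] [NormedSpace ℝ X]
    [NormedAddCommGroup Y] [NormedSpace ℝ Y] (φ : StrongDual ℝ X) (ψ : StrongDual ℝ Y) :
    StrongDual ℝ (WithLp 2 (X × Y)) :=
  (φ.coprod ψ).comp (WithLp.prodContinuousLinearEquiv 2 ℝ X Y).toContinuousLinearMap

theorem pairFunctional_apply {X Y : Type*} [NormedAddCommGroup X] [NormedSpace ℝ X]
    [NormedAddCommGroup Y] [NormedSpace ℝ Y] (φ : StrongDual ℝ X) (ψ : StrongDual ℝ Y)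
    (a : WithLp 2 (X × Y)) : pairFunctional φ ψ a = φ a.fst + ψ a.snd := rfl

theorem exists_apply_gt {X : Type*} [NormedAddCommGroup X] [NormedSpace ℝ X]
    (φ : StrongDual ℝ X) {ε : ℝ} (hε : 0 < ε) : ∃ x : X, ‖x‖ ≤ 1 ∧ ‖φ‖ - ε < φ x := by
  by_cases h : ‖φ‖ - ε < 0
  · exact ⟨0, by simp, by simpa using h⟩
  · obtain ⟨x, hx, hφ⟩ := φ.exists_lt_apply_of_lt_opNorm (show ‖φ‖ - ε < ‖φ‖ by linarith)
    rw [Real.norm_eq_abs, lt_abs] at hφ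
    rcases hφ with hφ | hφ
    · exact ⟨x, hx.le, hφ⟩
    · exact ⟨-x, by simpa using hx.le, by simpa using hφ⟩

theorem norm_pairFunctional {X Y : Type*} [NormedAddCommGroup X] [NormedSpace ℝ X]
    [NormedAddCommGroup Y] [NormedSpace ℝ Y] (φ : StrongDual ℝ X) (ψ : StrongDual ℝ Y) :
    ‖pairFunctional φ ψ‖ = √(‖φ‖ ^ 2 + ‖ψ‖ ^ 2) := by
  apply le_antisymm
  · refine ContinuousLinearMap.opNorm_le_bound _ (by positivity) fun a => ?_
    rw [pairFunctional_apply, WithLp.prod_norm_eq_of_L2, Real.norm_eq_abs,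
      ← Real.sqrt_mul (by positivity)]
    have h1 := φ.le_opNorm a.fst
    have h2 := ψ.le_opNorm a.snd
    rw [Real.norm_eq_abs] at h1 h2
    refine (abs_add_le _ _).trans (Real.le_sqrt_of_sq_le ?_)
    refine (pow_le_pow_left₀ (by positivity) (add_le_add h1 h2) 2).trans ?_
    nlinarith [sq_nonneg (‖φ‖ * ‖a.snd‖ - ‖ψ‖ * ‖a.fst‖)]
  · set N := ‖pairFunctional φ ψ‖
    set s := √(‖φ‖ ^ 2 + ‖ψ‖ ^ 2) with hs
    have hss : s * s = ‖φ‖ ^ 2 + ‖ψ‖ ^ 2 := Real.mul_self_sqrt (by positivity)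
    have hs0 : 0 ≤ s := Real.sqrt_nonneg _
    have hN0 : 0 ≤ N := norm_nonneg _
    have key : s * s ≤ N * s := by
      refine le_of_forall_pos_le_add fun δ hδ => ?_
      have hK : 0 < ‖φ‖ + ‖ψ‖ + 1 := by positivity
      obtain ⟨x, hx, hφ⟩ := exists_apply_gt φ (div_pos hδ hK)
      obtain ⟨y, hy, hψ⟩ := exists_apply_gt ψ (div_pos hδ hK)
      have hb := (pairFunctional φ ψ).le_opNorm (WithLp.toLp 2 (‖φ‖ • x, ‖ψ‖ • y))
      rw [pairFunctional_apply, WithLp.prod_norm_eq_of_L2, Real.norm_eq_abs] at hb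
      have hb' := (le_abs_self _).trans hb
      simp only [WithLp.toLp_fst, WithLp.toLp_snd, map_smul, smul_eq_mul, norm_smul, norm_norm] at hb'
      have hle : √((‖φ‖ * ‖x‖) ^ 2 + (‖ψ‖ * ‖y‖) ^ 2) ≤ s := by
        refine Real.sqrt_le_sqrt ?_
        gcongr
        · exact mul_le_of_le_one_right (norm_nonneg _) hx
        · exact mul_le_of_le_one_right (norm_nonneg _) hy
      have h1 := mul_le_mul_of_nonneg_left hφ.le (norm_nonneg φ)
      have h2 := mul_le_mul_of_nonneg_left hψ.le (norm_nonneg ψ)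
      have h3 := mul_le_mul_of_nonneg_left hle hN0
      have h4 : (‖φ‖ + ‖ψ‖ + 1) * (δ / (‖φ‖ + ‖ψ‖ + 1)) = δ := mul_div_cancel₀ _ hK.ne'
      have h5 : 0 < δ / (‖φ‖ + ‖ψ‖ + 1) := div_pos hδ hK
      nlinarith
    rcases hs0.eq_or_lt with h | h
    · rw [← h]; exact hN0
    · exact le_of_mul_le_mul_right key h

/-- The representation of the dual of `X × Y` by `X* × Y*` under the pairing
`⟨(x,y),(φ,ψ)⟩ = ⟨x,φ⟩ + ⟨y,ψ⟩`.  It is isometric: the dual norm is `√(‖φ‖² + ‖ψ‖²)`. -/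
noncomputable def dualProd (X Y : Type*) [NormedAddCommGroup X] [NormedSpace ℝ X]
    [NormedAddCommGroup Y] [NormedSpace ℝ Y] :
    WithLp 2 (StrongDual ℝ X × StrongDual ℝ Y) ≃ₗᵢ[ℝ] StrongDual ℝ (WithLp 2 (X × Y)) where
  toFun p := pairFunctional p.fst p.snd
  invFun f := WithLp.toLp 2
    ((f.comp (WithLp.prodContinuousLinearEquiv 2 ℝ X Y).symm.toContinuousLinearMap).comp
        (ContinuousLinearMap.inl ℝ X Y),
      (f.comp (WithLp.prodContinuousLinearEquiv 2 ℝ X Y).symm.toContinuousLinearMap).comp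
        (ContinuousLinearMap.inr ℝ X Y))
  map_add' p p' := by ext a; simp [pairFunctional_apply]; ring
  map_smul' r p := by ext a; simp [pairFunctional_apply]; ring
  left_inv p := by
    refine WithLp.ofLp_injective 2 (Prod.ext ?_ ?_) <;> ext x <;> simp [pairFunctional_apply]
  right_inv f := by
    ext a
    change f (WithLp.toLp 2 (a.fst, 0)) + f (WithLp.toLp 2 (0, a.snd)) = f a
    rw [← map_add]
    refine congrArg f ?_
    refine WithLp.ofLp_injective 2 (Prod.ext ?_ ?_) <;> simp
  norm_map' p := by
    rw [WithLp.prod_norm_eq_of_L2]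
    exact norm_pairFunctional _ _

theorem dualProd_apply (X Y : Type*) [NormedAddCommGroup X] [NormedSpace ℝ X]
    [NormedAddCommGroup Y] [NormedSpace ℝ Y] (p : WithLp 2 (StrongDual ℝ X × StrongDual ℝ Y))
    (a : WithLp 2 (X × Y)) : dualProd X Y p a = p.fst a.fst + p.snd a.snd := rfl

/-- The Banach SSD dual of `E × E*`: under the representation of `(E × E*)*` by `E* × E**`, the form
is `⌈(x*,x**),(y*,y**)⌉ = ⟨y*,x**⟩ + ⟨x*,y**⟩`. -/
noncomputable def prodSSDDual (E : Type*) [NormedAddCommGroup E] [NormedSpace ℝ E]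
    [CompleteSpace E] [Nontrivial E] : BanachSSDDual (prodSSD E) where
  toBanachSSD := (prodSSD (StrongDual ℝ E)).transport (dualProd E (StrongDual ℝ E))
  form_iota b c := by
    obtain ⟨p, rfl⟩ := (dualProd E (StrongDual ℝ E)).surjective c
    have h : (prodSSD E).iota b = dualProd E (StrongDual ℝ E)
        (WithLp.toLp 2 (b.snd, NormedSpace.inclusionInDoubleDual ℝ E b.fst)) := by
      ext a
      rw [BanachSSD.iota_apply, dualProd_apply]
      simp [prodSSD, add_comm]
    rw [h]
    simp [BanachSSD.transport, prodSSD, dualProd_apply, add_comm]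

/-- The point of `B* = (E × E*)*` represented by a pair in `E* × E**`. -/
noncomputable def toDual (E : Type*) [NormedAddCommGroup E] [NormedSpace ℝ E]
    (y : StrongDual ℝ E × StrongDual ℝ (StrongDual ℝ E)) :
    StrongDual ℝ (WithLp 2 (E × StrongDual ℝ E)) :=
  dualProd E (StrongDual ℝ E) (WithLp.toLp 2 y)

/-! Under `toDual`, the map `ι̃` sends `(y*, y**)` to the point `bidualPoint` of `B**` acting by
`(φ, ψ) ↦ ⟨φ, y**⟩ + ⟨y*, ψ⟩`. This is `A** y**` plus the canonical image of `(0, y*)`, where `A x =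
(x, 0)`. So everything rests on how `h**` interacts with affine maps: `(h ∘ (A + v₀))** = h** ∘ (A**
+ v₀)`, a Hahn–Banach statement (`fenchelBiconj_comp_affine`).

`T_D` is finer than the product: the functions `f(x)` and `‖x* - y₀*‖` on `B`, for `f ∈ CLB(E)`, lie
in `CLB(B)`, and their biconjugates at `bidualPoint` are `f**(y**)` and `‖y* - y₀*‖`.

The product is finer than `T_D`: with `y*` frozen, `h**` becomes the biconjugate of a `CLB(E)`
function at `y**`; moving `y*` costs little because `h**` is Lipschitz on bounded sets and `‖y**‖`
is `T_CLB`-continuous, being the biconjugate of the norm.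

For (b), the same freezing argument works for `⟨y*, y**⟩`, since evaluation at a fixed `y*` is the
biconjugate of `y*` itself. -/

open Filter Topology Metric

/-! ### Biconjugates via affine minorants; the norm and linear functionals. -/

section Conjugates

variable {X : Type*} [NormedAddCommGroup X] [NormedSpace ℝ X]

theorem fenchelConj_le_coe_iff {f : X → ℝ} {φ : StrongDual ℝ X} {c : ℝ} :
    fenchelConj f φ ≤ (c : EReal) ↔ ∀ x, φ x - f x ≤ c := by
  simp only [fenchelConj, iSup_le_iff, ← EReal.coe_sub, EReal.coe_le_coe_iff]

/-- The biconjugate is the supremum of the affine minorants. -/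
theorem fenchelBiconj_le_iff {f : X → ℝ} {ξ : StrongDual ℝ (StrongDual ℝ X)} {a : EReal} :
    fenchelBiconj f ξ ≤ a ↔
      ∀ (φ : StrongDual ℝ X) (c : ℝ), (∀ x, φ x - f x ≤ c) → ((ξ φ - c : ℝ) : EReal) ≤ a := by
  simp only [fenchelBiconj, iSup_le_iff]
  refine forall_congr' fun φ => ⟨fun h c hc => ?_, fun h => ?_⟩
  · refine le_trans ?_ h
    rw [EReal.coe_sub]
    exact EReal.sub_le_sub le_rfl (fenchelConj_le_coe_iff.2 hc)
  -- The conjugate is never `⊥`; where it is `⊤` the term contributes `⊥`, and where it is finite it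
  -- is itself an admissible `c`.
  · have hbot : fenchelConj f φ ≠ ⊥ := by
      intro hb
      have h0 : ((φ 0 : ℝ) : EReal) - (f 0 : EReal) ≤ fenchelConj f φ :=
        le_iSup (fun x : X => ((φ x : ℝ) : EReal) - (f x : EReal)) 0
      rw [hb, ← EReal.coe_sub, le_bot_iff] at h0
      exact EReal.coe_ne_bot _ h0
    rcases eq_or_ne (fenchelConj f φ) ⊤ with htop | htop
    · simp [htop]
    · have hc := EReal.coe_toReal htop hbot
      have := h (fenchelConj f φ).toReal (fenchelConj_le_coe_iff.1 hc.ge)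
      rwa [EReal.coe_sub, hc] at this

theorem le_fenchelBiconj {f : X → ℝ} (ξ : StrongDual ℝ (StrongDual ℝ X)) {φ : StrongDual ℝ X}
    {c : ℝ} (h : ∀ x, φ x - f x ≤ c) : ((ξ φ - c : ℝ) : EReal) ≤ fenchelBiconj f ξ :=
  fenchelBiconj_le_iff.1 le_rfl φ c h

/-- An affine minorant `φ - c` is at most `M` on the ball of radius `R`, so `R‖φ‖ - c ≤ M`, while `ξ
φ ≤ R‖φ‖`. -/
theorem fenchelBiconj_le_of_forall_norm_le {f : X → ℝ} {R M : ℝ} (hf : ∀ x, ‖x‖ ≤ R → f x ≤ M)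
    {ξ : StrongDual ℝ (StrongDual ℝ X)} (hξ : ‖ξ‖ ≤ R) : fenchelBiconj f ξ ≤ (M : EReal) := by
  have hR : 0 ≤ R := ξ.opNorm_nonneg.trans hξ
  refine fenchelBiconj_le_iff.2 fun φ c hc => EReal.coe_le_coe_iff.2 ?_
  have key : R * ‖φ‖ ≤ c + M := by
    refine le_of_forall_pos_le_add fun ε hε => ?_
    -- The denominator `R + 1` covers the case `R = 0`.
    obtain ⟨x, hx, hφ⟩ := exists_apply_gt φ (show 0 < ε / (R + 1) by positivity)
    have h1 := hc (R • x)
    have h2 := hf (R • x) (by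
      rw [norm_smul, Real.norm_of_nonneg hR]; exact mul_le_of_le_one_right hR hx)
    rw [map_smul, smul_eq_mul] at h1
    have h3 := mul_le_mul_of_nonneg_left hφ.le hR
    have h4 : R * (ε / (R + 1)) ≤ ε := by
      rw [mul_div_assoc', div_le_iff₀ (by positivity)]; nlinarith
    nlinarith
  have h1 : ξ φ ≤ ‖ξ‖ * ‖φ‖ := (le_abs_self _).trans (ξ.le_opNorm φ)
  have h2 := mul_le_mul_of_nonneg_right hξ (norm_nonneg φ)
  linarith

theorem fenchelBiconj_norm (ξ : StrongDual ℝ (StrongDual ℝ X)) :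
    fenchelBiconj (fun x : X => ‖x‖) ξ = ((‖ξ‖ : ℝ) : EReal) := by
  refine le_antisymm (fenchelBiconj_le_of_forall_norm_le (fun _ h => h) le_rfl) ?_
  refine EReal.ge_of_forall_gt_iff_ge.1 fun r hr => ?_
  rw [EReal.coe_lt_coe_iff] at hr
  obtain ⟨φ, hφ, h⟩ := exists_apply_gt ξ (sub_pos.2 hr)
  refine le_trans (EReal.coe_le_coe_iff.2 (by linarith)) (le_fenchelBiconj ξ (φ := φ) (c := 0) ?_)
  intro x
  have := (le_abs_self _).trans (φ.le_of_opNorm_le hφ x)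
  linarith

/-- The only affine minorants of `φ` are `φ - c` with `c ≥ 0`: a linear functional bounded above
vanishes. -/
theorem fenchelBiconj_clm (φ : StrongDual ℝ X) (ξ : StrongDual ℝ (StrongDual ℝ X)) :
    fenchelBiconj φ ξ = ((ξ φ : ℝ) : EReal) := by
  refine le_antisymm (fenchelBiconj_le_iff.2 fun ψ c h => EReal.coe_le_coe_iff.2 ?_) ?_
  · have hc : 0 ≤ c := by simpa using h 0
    have hψ : ψ = φ := by
      by_contra hne
      obtain ⟨x, hx⟩ : ∃ x, ψ x - φ x ≠ 0 := by
        by_contra! hcon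
        exact hne (ContinuousLinearMap.ext fun x => sub_eq_zero.1 (hcon x))
      have := h (((c + 1) / (ψ x - φ x)) • x)
      rw [map_smul, map_smul, smul_eq_mul, smul_eq_mul, ← mul_sub, div_mul_cancel₀ _ hx] at this
      linarith
    rw [hψ]; linarith
  · simpa using le_fenchelBiconj (f := φ) ξ (φ := φ) (c := 0) (by simp)

end Conjugates

/-! ### Biconjugates and affine maps. -/

section AffineMaps

variable {V W : Type*} [NormedAddCommGroup V] [NormedSpace ℝ V]
  [NormedAddCommGroup W] [NormedSpace ℝ W]

/-- An affine minorant of a convex continuous function on the range of an affine map extends to an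
affine minorant on the whole space. -/
theorem ConvexOn.exists_affine_minorant_extension {h : V → ℝ} (hconv : ConvexOn ℝ Set.univ h)
    (hcont : Continuous h) (A : W →L[ℝ] V) (v₀ : V) {φ : StrongDual ℝ W} {c : ℝ}
    (hφ : ∀ w, φ w - h (A w + v₀) ≤ c) :
    ∃ ψ : StrongDual ℝ V, ψ.comp A = φ ∧ ∀ v, ψ v - h v ≤ c + ψ v₀ := by
  -- Separate the open strict epigraph of `h` from the graph of the given minorant, transported to
  -- `V × ℝ` along `w ↦ A w + v₀`.
  obtain ⟨F, u, hU, hT⟩ := geometric_hahn_banach_open (E := V × ℝ)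
    (s := {p | p.1 ∈ Set.univ ∧ h p.1 < p.2}) (t := Set.range fun w => (A w + v₀, φ w - c))
    hconv.convex_strict_epigraph
    (by simpa using isOpen_lt (hcont.comp continuous_fst) continuous_snd)
    (by
      rintro _ ⟨w, rfl⟩ _ ⟨w', rfl⟩ a b - - hab
      refine ⟨a • w + b • w', Prod.ext ?_ ?_⟩
      · obtain rfl : b = 1 - a := by linarith
        simp only [map_add, map_smul, Prod.fst_add, Prod.smul_fst]
        module
      · obtain rfl : b = 1 - a := by linarith
        simp only [map_add, map_smul, Prod.snd_add, Prod.smul_snd, smul_eq_mul]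
        ring)
    (by
      rw [Set.disjoint_left]
      rintro _ ⟨-, hp⟩ ⟨w, rfl⟩
      have := hφ w
      simp only at hp
      linarith)
  set g : StrongDual ℝ V := F.comp (ContinuousLinearMap.inl ℝ V ℝ) with hg
  set s : ℝ := F (0, 1) with hs
  have hF : ∀ v t, F (v, t) = g v + s * t := by
    intro v t
    have : ((v, t) : V × ℝ) = (v, 0) + t • (0, 1) := by simp
    rw [this, map_add, map_smul, smul_eq_mul, mul_comm t]
    rfl
  have hU' : ∀ v t, h v < t → g v + s * t < u := fun v t hvt => by
    rw [← hF]; exact hU _ ⟨trivial, hvt⟩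
  have hT' : ∀ w, u ≤ g (A w) + g v₀ + s * (φ w - c) := fun w => by
    rw [← map_add, ← hF]; exact hT _ ⟨w, rfl⟩
  have h0 : u ≤ g v₀ - s * c := by simpa [sub_eq_add_neg] using hT' 0
  -- The separating hyperplane is not vertical, because the graph (at `w = 0`) and the epigraph both
  -- have points over `v₀`.
  have hs0 : s < 0 := by
    have h1 := hU' v₀ (h v₀ + 1) (by linarith)
    have h2 := hφ 0
    simp only [map_zero, zero_add, zero_sub] at h2
    by_contra! hcon
    nlinarith [mul_nonneg hcon (show 0 ≤ h v₀ + 1 + c by linarith)]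
  -- A linear functional bounded below on `W` vanishes; hence `g / (-s)` restricts to `φ` along `A`.
  have hlin : ∀ w, g (A w) + s * φ w = 0 := by
    intro w
    by_contra hne
    have := hT' (((u - g v₀ + s * c - 1) / (g (A w) + s * φ w)) • w)
    simp only [map_smul, smul_eq_mul] at this
    have h1 := div_mul_cancel₀ (u - g v₀ + s * c - 1) hne
    linarith
  refine ⟨(-s)⁻¹ • g, ?_, fun v => ?_⟩
  · ext w
    have := hlin w
    simp only [ContinuousLinearMap.comp_apply, smul_apply, smul_eq_mul]
    rw [inv_mul_eq_iff_eq_mul₀ (by linarith)]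
    linarith
  · have h1 : g v + s * h v ≤ g v₀ - s * c := by
      refine le_of_forall_pos_le_add fun ε hε => ?_
      have := hU' v (h v + ε / (-s)) (by
        have : 0 < ε / (-s) := div_pos hε (by linarith)
        linarith)
      have h2 : s * (ε / (-s)) = -ε := by rw [div_neg, mul_neg, mul_div_cancel₀ _ hs0.ne]
      rw [mul_add, h2] at this
      linarith
    simp only [smul_apply, smul_eq_mul]
    have hpos : 0 < (-s)⁻¹ := inv_pos.2 (by linarith)
    have h2 := mul_le_mul_of_nonneg_left h1 hpos.le
    have h3 : (-s)⁻¹ * s = -1 := by rw [inv_neg, neg_mul, inv_mul_cancel₀ hs0.ne]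
    have h4 : (-s)⁻¹ * (g v + s * h v) = (-s)⁻¹ * g v - h v := by
      rw [mul_add, ← mul_assoc, h3]; ring
    have h5 : (-s)⁻¹ * (g v₀ - s * c) = (-s)⁻¹ * g v₀ + c := by
      rw [mul_sub, ← mul_assoc, h3]; ring
    linarith

/-- The affine map `ξ ↦ A** ξ + v₀` between biduals extending `w ↦ A w + v₀`. -/
noncomputable def bidualAffine (A : W →L[ℝ] V) (v₀ : V) (ξ : StrongDual ℝ (StrongDual ℝ W)) :
    StrongDual ℝ (StrongDual ℝ V) :=
  ξ.comp ((ContinuousLinearMap.compL ℝ W V ℝ).flip A) + NormedSpace.inclusionInDoubleDual ℝ V v₀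

theorem bidualAffine_apply (A : W →L[ℝ] V) (v₀ : V) (ξ : StrongDual ℝ (StrongDual ℝ W))
    (ψ : StrongDual ℝ V) : bidualAffine A v₀ ξ ψ = ξ (ψ.comp A) + ψ v₀ := rfl

/-- Both sides are suprema over affine minorants, and those of the composite are exactly the
pullbacks of those of `h`; the nontrivial inclusion is the extension theorem. -/
theorem fenchelBiconj_comp_affine {h : V → ℝ} (hconv : ConvexOn ℝ Set.univ h)
    (hcont : Continuous h) (A : W →L[ℝ] V) (v₀ : V) (ξ : StrongDual ℝ (StrongDual ℝ W)) :
    fenchelBiconj (fun w => h (A w + v₀)) ξ = fenchelBiconj h (bidualAffine A v₀ ξ) := by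
  refine le_antisymm (fenchelBiconj_le_iff.2 fun φ c hφ => ?_)
    (fenchelBiconj_le_iff.2 fun ψ c hψ => ?_)
  · obtain ⟨ψ, rfl, hψ⟩ := hconv.exists_affine_minorant_extension hcont A v₀ hφ
    convert le_fenchelBiconj (bidualAffine A v₀ ξ) hψ using 2
    rw [bidualAffine_apply]; ring
  · convert le_fenchelBiconj (f := fun w => h (A w + v₀)) ξ (φ := ψ.comp A) (c := c - ψ v₀) ?_
      using 2
    · rw [bidualAffine_apply]; ring
    · intro w
      have := hψ (A w + v₀)
      rw [map_add] at this
      simp only [ContinuousLinearMap.comp_apply]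
      linarith

end AffineMaps

/-! ### The class `CLB` and local Lipschitz continuity of its biconjugates. -/

section CLB

variable {X V W : Type*} [NormedAddCommGroup X] [NormedSpace ℝ X] [NormedAddCommGroup V]
  [NormedSpace ℝ V] [NormedAddCommGroup W] [NormedSpace ℝ W]

theorem continuous_of_mem_CLB {h : X → ℝ} (hh : h ∈ CLB X) : Continuous h := by
  refine continuous_iff_continuousAt.2 fun x => ?_
  obtain ⟨K, hK⟩ := hh.2 (ball x 1) isBounded_ball
  exact hK.continuousOn.continuousAt (ball_mem_nhds x one_pos)

theorem comp_affine_mem_CLB {h : V → ℝ} (hh : h ∈ CLB V) (A : W →L[ℝ] V) (v₀ : V) :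
    (fun w => h (A w + v₀)) ∈ CLB W := by
  constructor
  · have := hh.1.comp_affineMap (A.toLinearMap.toAffineMap + AffineMap.const ℝ W v₀)
    rwa [Set.preimage_univ] at this
  · intro s hs
    have hL : LipschitzWith ‖A‖₊ fun w => A w + v₀ := by
      simpa using A.lipschitz.add (LipschitzWith.const v₀)
    obtain ⟨K, hK⟩ := hh.2 _ (hL.isBounded_image hs)
    exact ⟨K * ‖A‖₊, hK.comp hL.lipschitzOnWith (Set.mapsTo_image _ _)⟩

theorem norm_mem_CLB : (fun x : X => ‖x‖) ∈ CLB X :=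
  ⟨convexOn_univ_norm, fun _ _ => ⟨1, lipschitzWith_one_norm.lipschitzOnWith⟩⟩

theorem clm_mem_CLB (φ : StrongDual ℝ X) : (φ : X → ℝ) ∈ CLB X :=
  ⟨φ.toLinearMap.convexOn convex_univ, fun _ _ => ⟨_, φ.lipschitz.lipschitzOnWith⟩⟩

theorem exists_forall_le_of_mem_CLB {h : X → ℝ} (hh : h ∈ CLB X) (R : ℝ) :
    ∃ M, ∀ x, ‖x‖ ≤ R → h x ≤ M := by
  -- `max R 0` keeps the centre in the ball when `R` is negative.
  obtain ⟨K, hK⟩ := hh.2 (closedBall 0 (max R 0)) isBounded_closedBall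
  refine ⟨h 0 + K * max R 0, fun x hx => ?_⟩
  have hx' : ‖x‖ ≤ max R 0 := hx.trans (le_max_left _ _)
  have h1 := hK.dist_le_mul x (by simpa using hx') 0 (by simp)
  rw [dist_zero_right, Real.dist_eq] at h1
  have h2 := mul_le_mul_of_nonneg_left hx' K.2
  have h3 := le_abs_self (h x - h 0)
  simp only [NNReal.val_eq_coe] at h2
  linarith

/-- The finite biconjugate of a function in `CLB`. -/
noncomputable def realBiconj (h : X → ℝ) (ξ : StrongDual ℝ (StrongDual ℝ X)) : ℝ :=
  (fenchelBiconj h ξ).toReal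

theorem exists_affine_minorant_of_mem_CLB {h : X → ℝ} (hh : h ∈ CLB X) :
    ∃ (φ : StrongDual ℝ X) (c : ℝ), ∀ x, φ x - h x ≤ c := by
  -- With the zero map for `A`, this is the existence of a subgradient of `h` at `0`.
  obtain ⟨ψ, -, hψ⟩ := hh.1.exists_affine_minorant_extension (continuous_of_mem_CLB hh)
    (0 : X →L[ℝ] X) 0 (φ := 0) (c := -h 0) (by simp)
  exact ⟨ψ, _, hψ⟩

theorem coe_realBiconj {h : X → ℝ} (hh : h ∈ CLB X) (ξ : StrongDual ℝ (StrongDual ℝ X)) :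
    ((realBiconj h ξ : ℝ) : EReal) = fenchelBiconj h ξ := by
  obtain ⟨M, hM⟩ := exists_forall_le_of_mem_CLB hh ‖ξ‖
  obtain ⟨φ, c, hφ⟩ := exists_affine_minorant_of_mem_CLB hh
  refine EReal.coe_toReal (ne_top_of_le_ne_top (EReal.coe_ne_top M)
    (fenchelBiconj_le_of_forall_norm_le hM le_rfl)) ?_
  exact ne_bot_of_le_ne_bot (EReal.coe_ne_bot _) (le_fenchelBiconj ξ hφ)

theorem realBiconj_le_iff {h : X → ℝ} (hh : h ∈ CLB X) {ξ : StrongDual ℝ (StrongDual ℝ X)}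
    {a : ℝ} : realBiconj h ξ ≤ a ↔
      ∀ (φ : StrongDual ℝ X) (c : ℝ), (∀ x, φ x - h x ≤ c) → ξ φ - c ≤ a := by
  rw [← EReal.coe_le_coe_iff, coe_realBiconj hh, fenchelBiconj_le_iff]
  simp only [EReal.coe_le_coe_iff]

theorem convexOn_realBiconj {h : X → ℝ} (hh : h ∈ CLB X) :
    ConvexOn ℝ Set.univ (realBiconj h) := by
  refine ⟨convex_univ, fun ξ _ η _ a b ha hb hab => (realBiconj_le_iff hh).2 fun φ c hc => ?_⟩
  have h1 := mul_le_mul_of_nonneg_left ((realBiconj_le_iff hh).1 (le_refl (realBiconj h ξ)) φ c hc)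
    ha
  have h2 := mul_le_mul_of_nonneg_left ((realBiconj_le_iff hh).1 (le_refl (realBiconj h η)) φ c hc)
    hb
  obtain rfl : b = 1 - a := by linarith
  simp only [add_apply, smul_apply, smul_eq_mul]
  linarith

theorem ConvexOn.exists_lipschitzOnWith_ball {f : X → ℝ} (hf : ConvexOn ℝ Set.univ f) {R a b : ℝ}
    (hfa : ∀ x, ‖x‖ ≤ R + 1 → a ≤ f x) (hfb : ∀ x, ‖x‖ ≤ R + 1 → f x ≤ b) :
    ∃ K : NNReal, LipschitzOnWith K f (ball 0 R) := by
  refine (hf.subset (Set.subset_univ _) (convex_ball 0 (R + 1))).exists_lipschitzOnWith_of_isBounded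
    (lt_add_one R) ((isBounded_Icc a b).subset ?_)
  rintro _ ⟨x, hx, rfl⟩
  rw [mem_ball_zero_iff] at hx
  exact ⟨hfa x hx.le, hfb x hx.le⟩

/-- On the ball of radius `R + 1`, `h**` is bounded above by a bound for `h` on the ball of that
radius and below by an affine minorant; a bounded convex function is Lipschitz on a smaller
concentric ball. -/
theorem exists_lipschitzOnWith_realBiconj {h : X → ℝ} (hh : h ∈ CLB X) (R : ℝ) :
    ∃ K : NNReal, LipschitzOnWith K (realBiconj h) (ball 0 R) := by
  obtain ⟨M, hM⟩ := exists_forall_le_of_mem_CLB hh (R + 1)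
  obtain ⟨φ, c, hφ⟩ := exists_affine_minorant_of_mem_CLB hh
  have key := ConvexOn.exists_lipschitzOnWith_ball (X := StrongDual ℝ (StrongDual ℝ X))
    (f := realBiconj h) (R := R) (a := -((R + 1) * ‖φ‖) - c) (b := M)
  have key₁ := key (convexOn_realBiconj hh)
  have hlow : ∀ ξ : StrongDual ℝ (StrongDual ℝ X), ‖ξ‖ ≤ R + 1 →
      -((R + 1) * ‖φ‖) - c ≤ realBiconj h ξ := fun ξ hξ => by
    have h1 := (realBiconj_le_iff hh).1 (le_refl (realBiconj h ξ)) φ c hφ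
    have h2 := ξ.le_of_opNorm_le hξ φ
    rw [Real.norm_eq_abs] at h2
    have h3 := (abs_le.1 h2).1
    linarith
  have hup : ∀ ξ : StrongDual ℝ (StrongDual ℝ X), ‖ξ‖ ≤ R + 1 → realBiconj h ξ ≤ M :=
    fun ξ hξ => by
      rw [← EReal.coe_le_coe_iff, coe_realBiconj hh]
      exact fenchelBiconj_le_of_forall_norm_le hM hξ
  have key₂ := key₁ hlow
  exact key₂ hup

end CLB

/-! ### Continuity criteria for `T_CLB`. -/

section Topologies

variable {X : Type*} [NormedAddCommGroup X] [NormedSpace ℝ X]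

theorem continuous_TCLB_iff {T : Type*} [t : TopologicalSpace T]
    {f : T → StrongDual ℝ (StrongDual ℝ X)} :
    Continuous[t, TCLB X] f ↔ ∀ h ∈ CLB X, Continuous fun s => realBiconj h (f s) := by
  simp only [continuous_iInf_rng, continuous_induced_rng]
  refine forall₂_congr fun h hh => ?_
  rw [← EReal.continuous_coe_iff]
  simp only [coe_realBiconj hh]
  rfl

theorem realBiconj_norm (ξ : StrongDual ℝ (StrongDual ℝ X)) :
    realBiconj (fun x : X => ‖x‖) ξ = ‖ξ‖ := by
  rw [realBiconj, fenchelBiconj_norm, EReal.toReal_coe]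

theorem realBiconj_clm (φ : StrongDual ℝ X) (ξ : StrongDual ℝ (StrongDual ℝ X)) :
    realBiconj φ ξ = ξ φ := by
  rw [realBiconj, fenchelBiconj_clm, EReal.toReal_coe]

theorem realBiconj_comp_affine {V W : Type*} [NormedAddCommGroup V] [NormedSpace ℝ V]
    [NormedAddCommGroup W] [NormedSpace ℝ W] {h : V → ℝ} (hh : h ∈ CLB V) (A : W →L[ℝ] V)
    (v₀ : V) (ξ : StrongDual ℝ (StrongDual ℝ W)) :
    realBiconj (fun w => h (A w + v₀)) ξ = realBiconj h (bidualAffine A v₀ ξ) := by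
  rw [realBiconj, fenchelBiconj_comp_affine hh.1 (continuous_of_mem_CLB hh), realBiconj]

/-- Joint continuity of `h**` along a family of affine embeddings of the bidual whose translation
part varies norm-continuously. -/
theorem continuous_realBiconj_bidualAffine {V W T : Type*} [NormedAddCommGroup V] [NormedSpace ℝ V]
    [NormedAddCommGroup W] [NormedSpace ℝ W] [TopologicalSpace T] {A : W →L[ℝ] V} {v : T → V}
    {ξ : T → StrongDual ℝ (StrongDual ℝ W)} (hv : Continuous v)
    (hξ : ∀ f ∈ CLB W, Continuous fun t => realBiconj f (ξ t)) {h : V → ℝ} (hh : h ∈ CLB V) :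
    Continuous fun t => realBiconj h (bidualAffine A (v t) (ξ t)) := by
  refine continuous_iff_continuousAt.2 fun t₀ => ?_
  have hnorm : Continuous fun t => ‖ξ t‖ := by
    simpa only [realBiconj_norm] using hξ _ norm_mem_CLB
  have hbound : ∀ (x : V) (η : StrongDual ℝ (StrongDual ℝ W)),
      ‖bidualAffine A x η‖ ≤ ‖η‖ * ‖A‖ + ‖x‖ := by
    intro x η
    refine ContinuousLinearMap.opNorm_le_bound _ (by positivity) fun ψ => ?_
    rw [bidualAffine_apply]
    refine (norm_add_le _ _).trans ?_
    have h1 : ‖η (ψ.comp A)‖ ≤ ‖η‖ * (‖ψ‖ * ‖A‖) :=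
      (η.le_opNorm _).trans (by gcongr; exact ψ.opNorm_comp_le A)
    have h2 := ψ.le_opNorm x
    linarith
  have hsub : ∀ (x y : V) (η : StrongDual ℝ (StrongDual ℝ W)),
      dist (bidualAffine A x η) (bidualAffine A y η) ≤ ‖x - y‖ := by
    intro x y η
    have heq : bidualAffine A x η - bidualAffine A y η =
        NormedSpace.inclusionInDoubleDual ℝ V (x - y) := by
      ext ψ
      change bidualAffine A x η ψ - bidualAffine A y η ψ = ψ (x - y)
      rw [bidualAffine_apply, bidualAffine_apply, map_sub, add_sub_add_left_eq_sub]
    refine (dist_eq_norm (E := StrongDual ℝ (StrongDual ℝ V)) _ _).trans_le ?_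
    exact (congrArg norm heq).trans_le (NormedSpace.double_dual_bound ℝ V (x - y))
  -- For `t` near `t₀`, both the moving point and the point with translation frozen at `v t₀` lie in
  -- this ball.
  set R : ℝ := (‖ξ t₀‖ + 1) * ‖A‖ + (‖v t₀‖ + 1) with hR
  obtain ⟨K, hK⟩ := exists_lipschitzOnWith_realBiconj hh R
  -- With the translation frozen, this is the biconjugate of a single `CLB(W)` function at `ξ t`.
  have hmain : Tendsto (fun t => realBiconj h (bidualAffine A (v t₀) (ξ t))) (𝓝 t₀)
      (𝓝 (realBiconj h (bidualAffine A (v t₀) (ξ t₀)))) := by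
    simpa only [realBiconj_comp_affine hh] using
      (hξ _ (comp_affine_mem_CLB hh A (v t₀))).tendsto t₀
  have hK0 : Tendsto (fun t => (K : ℝ) * ‖v t - v t₀‖) (𝓝 t₀) (𝓝 0) := by
    simpa using ((hv.sub continuous_const).norm.const_mul (K : ℝ)).tendsto' t₀ 0 (by simp)
  refine tendsto_of_tendsto_of_dist hmain (squeeze_zero' (.of_forall fun _ => dist_nonneg) ?_ hK0)
  filter_upwards [hnorm.continuousAt.eventually_lt continuousAt_const (lt_add_one ‖ξ t₀‖),
    hv.norm.continuousAt.eventually_lt continuousAt_const (lt_add_one ‖v t₀‖)] with t h1 h2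
  have hA := mul_le_mul_of_nonneg_right h1.le (norm_nonneg A)
  have m1 : bidualAffine A (v t) (ξ t) ∈ ball 0 R := by
    refine (mem_ball_zero_iff (E := StrongDual ℝ (StrongDual ℝ V))).2 ?_
    exact (hbound _ _).trans_lt (by rw [hR]; linarith)
  have m2 : bidualAffine A (v t₀) (ξ t) ∈ ball 0 R := by
    refine (mem_ball_zero_iff (E := StrongDual ℝ (StrongDual ℝ V))).2 ?_
    exact (hbound _ _).trans_lt (by rw [hR]; linarith)
  rw [dist_comm]
  exact (hK.dist_le_mul _ m1 _ m2).trans (mul_le_mul_of_nonneg_left (hsub _ _ _) K.2)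

/-- The evaluation pairing is continuous for the norm topology on `X*` and `T_CLB` on `X**`. -/
theorem continuous_dual_pairing {T : Type*} [TopologicalSpace T] {y : T → StrongDual ℝ X}
    {z : T → StrongDual ℝ (StrongDual ℝ X)} (hy : Continuous y)
    (hz : ∀ f ∈ CLB X, Continuous fun t => realBiconj f (z t)) : Continuous fun t => z t (y t) := by
  refine continuous_iff_continuousAt.2 fun t₀ => ?_
  have hnorm : Continuous fun t => ‖z t‖ := by
    simpa only [realBiconj_norm] using hz _ norm_mem_CLB
  have h1 : Continuous fun t => z t (y t₀) := by
    simpa only [realBiconj_clm] using hz _ (clm_mem_CLB (y t₀))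
  -- This bounds the error of freezing `y` at `t₀`; continuity of `‖z t‖` keeps the first factor
  -- under control.
  have h2 : Tendsto (fun t => ‖z t‖ * ‖y t - y t₀‖) (𝓝 t₀) (𝓝 0) :=
    (hnorm.mul (hy.sub continuous_const).norm).tendsto' t₀ 0 (by simp)
  refine tendsto_of_tendsto_of_dist (h1.tendsto t₀) (squeeze_zero (fun _ => dist_nonneg) ?_ h2)
  intro t
  rw [dist_comm, dist_eq_norm, ← map_sub]
  exact (z t).le_opNorm _

end Topologies

/-! ### The product `E × E*` and the two claims. -/

section Product

variable {E : Type*} [NormedAddCommGroup E] [NormedSpace ℝ E]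

/-- The embedding `x ↦ (x, 0)` of `E` in `E × E*`. -/
noncomputable def inlL2 (E : Type*) [NormedAddCommGroup E] [NormedSpace ℝ E] :
    E →L[ℝ] WithLp 2 (E × StrongDual ℝ E) :=
  (WithLp.prodContinuousLinearEquiv 2 ℝ E (StrongDual ℝ E)).symm.toContinuousLinearMap.comp
    (ContinuousLinearMap.inl ℝ E (StrongDual ℝ E))

theorem inlL2_apply (x : E) : inlL2 E x = WithLp.toLp 2 (x, 0) := rfl

/-- The point `(y**, ŷ*)` of `(E × E*)**` represented in `E** × E***`. -/
noncomputable def bidualPoint (p : StrongDual ℝ E × StrongDual ℝ (StrongDual ℝ E)) :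
    StrongDual ℝ (StrongDual ℝ (WithLp 2 (E × StrongDual ℝ E))) :=
  bidualAffine (inlL2 E) (WithLp.toLp 2 (0, p.1)) p.2

theorem bidualPoint_pairFunctional (p : StrongDual ℝ E × StrongDual ℝ (StrongDual ℝ E))
    (φ : StrongDual ℝ E) (ψ : StrongDual ℝ (StrongDual ℝ E)) :
    bidualPoint p (pairFunctional φ ψ) = p.2 φ + ψ p.1 := by
  have : (pairFunctional φ ψ).comp (inlL2 E) = φ := by
    ext x
    simp [pairFunctional_apply, inlL2_apply]
  rw [bidualPoint, bidualAffine_apply, this, pairFunctional_apply]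
  simp

theorem bidualAffine_fst_bidualPoint (p : StrongDual ℝ E × StrongDual ℝ (StrongDual ℝ E)) :
    bidualAffine (WithLp.fstL 2 ℝ E (StrongDual ℝ E)) 0 (bidualPoint p) = p.2 := by
  ext φ
  have : φ.comp (WithLp.fstL 2 ℝ E (StrongDual ℝ E)) = pairFunctional φ 0 := by
    ext a
    simp [pairFunctional_apply]
  rw [bidualAffine_apply, this, bidualPoint_pairFunctional]
  simp

/-- The second component lies in the canonical copy of `E*` in its bidual, so the biconjugate of the
norm there measures the norm distance in `E*`. -/
theorem bidualAffine_snd_bidualPoint (p : StrongDual ℝ E × StrongDual ℝ (StrongDual ℝ E))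
    (y : StrongDual ℝ E) :
    bidualAffine (WithLp.sndL 2 ℝ E (StrongDual ℝ E)) y (bidualPoint p) =
      NormedSpace.inclusionInDoubleDual ℝ (StrongDual ℝ E) (p.1 + y) := by
  ext ψ
  have : ψ.comp (WithLp.sndL 2 ℝ E (StrongDual ℝ E)) = pairFunctional 0 ψ := by
    ext a
    simp [pairFunctional_apply]
  rw [bidualAffine_apply, this, bidualPoint_pairFunctional, NormedSpace.dual_def]
  simp

theorem continuous_of_realBiconj_bidualPoint {T : Type*} [TopologicalSpace T]
    {p : T → StrongDual ℝ E × StrongDual ℝ (StrongDual ℝ E)}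
    (hp : ∀ h ∈ CLB (WithLp 2 (E × StrongDual ℝ E)),
      Continuous fun t => realBiconj h (bidualPoint (p t))) :
    (Continuous fun t => (p t).1) ∧ ∀ f ∈ CLB E, Continuous fun t => realBiconj f (p t).2 := by
  constructor
  · refine continuous_iff_continuousAt.2 fun t₀ => tendsto_iff_norm_sub_tendsto_zero.2 ?_
    -- A separate test function for each `t₀`: the distance of the second coordinate from `(p
    -- t₀).1`.
    have heq : ∀ t, realBiconj (fun a : WithLp 2 (E × StrongDual ℝ E) =>
        ‖WithLp.sndL 2 ℝ E (StrongDual ℝ E) a + -(p t₀).1‖) (bidualPoint (p t)) =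
          ‖(p t).1 - (p t₀).1‖ := fun t => by
      refine (realBiconj_comp_affine (norm_mem_CLB (X := StrongDual ℝ E)) _ _ _).trans ?_
      rw [bidualAffine_snd_bidualPoint, ← sub_eq_add_neg]
      exact (realBiconj_norm _).trans ((NormedSpace.inclusionInDoubleDualLi ℝ).norm_map _)
    have h1 := hp _ (comp_affine_mem_CLB (norm_mem_CLB (X := StrongDual ℝ E))
      (WithLp.sndL 2 ℝ E (StrongDual ℝ E)) (-(p t₀).1))
    refine h1.tendsto' t₀ 0 ((heq t₀).trans (by simp)) |>.congr heq
  · intro f hf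
    have h1 := hp _ (comp_affine_mem_CLB hf (WithLp.fstL 2 ℝ E (StrongDual ℝ E)) 0)
    simpa only [realBiconj_comp_affine hf, bidualAffine_fst_bidualPoint] using h1

theorem continuous_realBiconj_bidualPoint {T : Type*} [TopologicalSpace T]
    {p : T → StrongDual ℝ E × StrongDual ℝ (StrongDual ℝ E)} (h₁ : Continuous fun t => (p t).1)
    (h₂ : ∀ f ∈ CLB E, Continuous fun t => realBiconj f (p t).2)
    {h : WithLp 2 (E × StrongDual ℝ E) → ℝ} (hh : h ∈ CLB (WithLp 2 (E × StrongDual ℝ E))) :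
    Continuous fun t => realBiconj h (bidualPoint (p t)) :=
  continuous_realBiconj_bidualAffine
    ((WithLp.prod_continuous_toLp 2 E (StrongDual ℝ E)).comp (continuous_const.prodMk h₁)) h₂ hh

variable [CompleteSpace E] [Nontrivial E]

theorem prodSSDDual_form_toDual (p r : StrongDual ℝ E × StrongDual ℝ (StrongDual ℝ E)) :
    (prodSSDDual E).form (toDual E p) (toDual E r) = r.2 p.1 + p.2 r.1 := by
  simp [prodSSDDual, toDual, BanachSSD.transport, prodSSD]

/-- This turns `T_D` into the topology induced by an explicit affine expression in `y**` and `y*`.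
-/
theorem prodSSDDual_iota_toDual (p : StrongDual ℝ E × StrongDual ℝ (StrongDual ℝ E)) :
    (prodSSDDual E).iota (toDual E p) = bidualPoint p := by
  ext c
  obtain ⟨r, rfl⟩ := (dualProd E (StrongDual ℝ E)).surjective c
  rw [BanachSSD.iota_apply]
  refine (prodSSDDual_form_toDual r.ofLp p).trans ?_
  exact (bidualPoint_pairFunctional p r.fst r.snd).symm

omit [CompleteSpace E] [Nontrivial E] in
theorem toDual_surjective : Function.Surjective (toDual E) :=
  (dualProd E (StrongDual ℝ E)).surjective.comp (WithLp.toLp_surjective 2)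

theorem prodSSDDual_q_toDual (p : StrongDual ℝ E × StrongDual ℝ (StrongDual ℝ E)) :
    (prodSSDDual E).q (toDual E p) = p.2 p.1 := by
  rw [BanachSSD.q, prodSSDDual_form_toDual]
  ring

theorem induced_toDual_TD :
    TopologicalSpace.induced (toDual E) (TD (prodSSDDual E)) =
      TopologicalSpace.induced bidualPoint (TCLB (WithLp 2 (E × StrongDual ℝ E))) := by
  rw [induced_compose]
  exact congrArg (fun f => TopologicalSpace.induced f _) (funext prodSSDDual_iota_toDual)

theorem induced_toDual_TD_eq_prod :
    TopologicalSpace.induced (toDual E) (TD (prodSSDDual E)) =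
      @instTopologicalSpaceProd (StrongDual ℝ E) (StrongDual ℝ (StrongDual ℝ E))
        (normTopology (StrongDual ℝ E)) (TCLB E) := by
  rw [induced_toDual_TD]
  apply le_antisymm
  -- The identity map is tested: both coordinates are continuous for the topology pulled back from
  -- `T_CLB(B**)`.
  · let t := TopologicalSpace.induced (bidualPoint (E := E))
      (TCLB (WithLp 2 (E × StrongDual ℝ E)))
    obtain ⟨h₁, h₂⟩ := continuous_of_realBiconj_bidualPoint (p := fun p => p)
      (@continuous_TCLB_iff _ _ _ _ t _ |>.1 (@continuous_induced_dom _ _ _ _))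
    exact le_inf (continuous_iff_le_induced.1 h₁)
      (continuous_iff_le_induced.1 (@continuous_TCLB_iff _ _ _ _ t _ |>.2 h₂))
  · let t := @instTopologicalSpaceProd (StrongDual ℝ E) (StrongDual ℝ (StrongDual ℝ E))
      (normTopology (StrongDual ℝ E)) (TCLB E)
    refine continuous_iff_le_induced.1 (@continuous_TCLB_iff _ _ _ _ t _ |>.2 fun h hh => ?_)
    exact @continuous_realBiconj_bidualPoint _ _ _ _ t _
      (@continuous_fst _ _ (normTopology (StrongDual ℝ E)) (TCLB E))
      (@continuous_TCLB_iff _ _ _ _ t _ |>.1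
        (@continuous_snd _ _ (normTopology (StrongDual ℝ E)) (TCLB E))) _ hh

theorem continuous_prodSSDDual_q :
    @Continuous _ ℝ (TD (prodSSDDual E)) inferInstance (prodSSDDual E).q := by
  let e : (StrongDual ℝ E × StrongDual ℝ (StrongDual ℝ E)) ≃
      StrongDual ℝ (WithLp 2 (E × StrongDual ℝ E)) :=
    Equiv.ofBijective (toDual E)
      ⟨(dualProd E (StrongDual ℝ E)).injective.comp (WithLp.toLp_injective 2), toDual_surjective⟩
  -- Coordinates on `B*` reduce the claim to continuity of the pairing of the two components under
  -- `T_D`.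
  let π := fun b => e.symm b
  have hπ : ∀ b, (prodSSDDual E).iota b = bidualPoint (π b) := fun b => by
    rw [← prodSSDDual_iota_toDual]
    exact congrArg _ (e.apply_symm_apply b).symm
  have hq : (prodSSDDual E).q = fun b => (π b).2 (π b).1 := funext fun b => by
    rw [← prodSSDDual_q_toDual]
    exact congrArg _ (e.apply_symm_apply b).symm
  let t := TD (prodSSDDual E)
  have hι := @continuous_TCLB_iff _ _ _ _ t _ |>.1
    (@continuous_induced_dom _ _ (prodSSDDual E).iota (TCLB (WithLp 2 (E × StrongDual ℝ E))))
  simp only [hπ] at hι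
  obtain ⟨h₁, h₂⟩ := @continuous_of_realBiconj_bidualPoint _ _ _ _ t _ hι
  rw [hq]
  exact @continuous_dual_pairing _ _ _ _ t _ _ h₁ h₂

end Product

theorem theorem8p3 (E : Type*) [NormedAddCommGroup E] [NormedSpace ℝ E] [CompleteSpace E]
    [Nontrivial E] :
    TopologicalSpace.induced (toDual E) (TD (prodSSDDual E)) =
        @instTopologicalSpaceProd (StrongDual ℝ E) (StrongDual ℝ (StrongDual ℝ E))
          (normTopology (StrongDual ℝ E)) (TCLB E) ∧
      (∀ (y : StrongDual ℝ E) (z : StrongDual ℝ (StrongDual ℝ E)),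
        (prodSSDDual E).q (toDual E (y, z)) = z y) ∧
      @Continuous _ ℝ (TD (prodSSDDual E)) inferInstance (prodSSDDual E).q :=
  ⟨induced_toDual_TD_eq_prod, fun y z => prodSSDDual_q_toDual (y, z), continuous_prodSSDDual_q⟩
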